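/- Write $M_d$ for the complex $d\times d$ matrices. A state in $M_d$ is a positive semidefinite matrix of trace $1$; a channel is a completely positive, trace preserving linear map between matrix algebras. Channels $\Phi:M_d\to M_{d_{\mathrm{out}}}$ and $\Phi_c:M_d\to M_{d_{\mathrm{env}}}$ are complementary if there is an isometry $V:\mathbb{C}^d\to\mathbb{C}^{d_{\mathrm{out}}}\otimes\mathbb{C}^{d_{\mathrm{env}}}$ with $\Phi(X)=\operatorname{Tr}_{\mathrm{env}}(VXV^\dagger)$ and $\Phi_c(X)=\operatorname{Tr}_{\mathrm{out}}(VXV^\dagger)$ for all $X\in M_d$. Let $S(\rho)=-\operatorname{Tr}(\rho\log\rho)$ be the von Neumann entropy. The coherent information of $\Phi$ is $$\mathcal{Q}^{(1)}(\Phi)=\max_{\rho}\bigl(S[\Phi(\rho)]-S[\Phi_c(\rho)]\bigr),$$ the maximum being over all states $\rho\in M_d$ (the value does not depend on the channel $\Phi_c$ complementary to $\Phi$), and the quantum capacity of $\Phi$ is $$\mathcal{Q}(\Phi)=\lim_{n\to\infty}\frac{\mathcal{Q}^{(1)}(\Phi^{\otimes n})}{n}.$$ Theorem 3.1. Let $\Phi:M_d\to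 M_{d_{\mathrm{out}}}$ and $\Phi_c:M_d\to M_{d_{\mathrm{env}}}$ be complementary channels. For a unit vector $\psi\in\mathbb{C}^d$, let $K_\psi$ and $K^c_\psi$ be the orthogonal projections onto $\ker\Phi(|\psi\rangle\langle\psi|)$ and $\ker\Phi_c(|\psi\rangle\langle\psi|)$, respectively. (i) If there exist a unit vector $\psi\in\mathbb{C}^d$ and a state $\sigma\in M_d$ with $\operatorname{Tr}(K_\psi\Phi(\sigma))>\operatorname{Tr}(K^c_\psi\Phi_c(\sigma))$, then $\mathcal{Q}(\Phi)\ge\mathcal{Q}^{(1)}(\Phi)>0$. (ii) If there exist a unit vector $\psi\in\mathbb{C}^d$ and a state $\sigma\in M_d$ with $\operatorname{Tr}(K_\psi\Phi(\sigma))<\operatorname{Tr}(K^c_\psi\Phi_c(\sigma))$, then $\mathcal{Q}(\Phi_c)\ge\mathcal{Q}^{(1)}(\Phi_c)>0$. In each case it is part of the claim that the maximum defining $\mathcal{Q}^{(1)}$ is attained and that the limit defining $\mathcal{Q}$ exists. -/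

import Mathlib

open scoped Matrix ComplexOrder

/-! Index types `A`, `B`, `C`, `E` are finite; `Matrix A A ℂ` is the algebra of operators on `ℂ^A`, and
operators on `ℂ^B ⊗ ℂ^C` are matrices indexed by `B × C`. -/

namespace QuantumCapacity

noncomputable section

/-- A quantum state: a positive semidefinite matrix of unit trace. -/
def IsState {A : Type} [Fintype A] (ρ : Matrix A A ℂ) : Prop :=
  ρ.PosSemidef ∧ ρ.trace = 1

/-- `|ψ⟩⟨ψ|`. -/
def pureState {A : Type} (ψ : A → ℂ) : Matrix A A ℂ :=
  Matrix.vecMulVec ψ (star ψ)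

/-- `Φ ⊗ id_k`: apply `Φ` to the first tensor factor of a matrix on `ℂ^A ⊗ ℂ^k`. -/
def ampliation {A B : Type} (k : ℕ) (Φ : Matrix A A ℂ →ₗ[ℂ] Matrix B B ℂ)
    (M : Matrix (A × Fin k) (A × Fin k) ℂ) : Matrix (B × Fin k) (B × Fin k) ℂ :=
  Matrix.of fun p q => Φ (Matrix.of fun i j => M (i, p.2) (j, q.2)) p.1 q.1

/-- A quantum channel: a completely positive and trace preserving linear map. -/
def IsChannel {A B : Type} [Fintype A] [Fintype B]
    (Φ : Matrix A A ℂ →ₗ[ℂ] Matrix B B ℂ) : Prop :=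
  (∀ (k : ℕ) (M : Matrix (A × Fin k) (A × Fin k) ℂ),
    M.PosSemidef → (ampliation k Φ M).PosSemidef) ∧
  ∀ X : Matrix A A ℂ, (Φ X).trace = X.trace

/-- Partial trace over the second tensor factor. -/
def traceSnd {B C : Type} [Fintype C] (M : Matrix (B × C) (B × C) ℂ) : Matrix B B ℂ :=
  Matrix.of fun i j => ∑ k, M (i, k) (j, k)

/-- Partial trace over the first tensor factor. -/
def traceFst {B C : Type} [Fintype B] (M : Matrix (B × C) (B × C) ℂ) : Matrix C C ℂ :=
  Matrix.of fun k l => ∑ i, M (i, k) (i, l)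

/-- `Φ` and `Φc` are complementary to each other: they arise from one Stinespring isometry
`V : ℂ^A → ℂ^B ⊗ ℂ^C` by tracing out one of the two output factors. -/
def IsComplementary {A B C : Type} [Fintype A] [DecidableEq A] [Fintype B] [Fintype C]
    (Φ : Matrix A A ℂ →ₗ[ℂ] Matrix B B ℂ) (Φc : Matrix A A ℂ →ₗ[ℂ] Matrix C C ℂ) : Prop :=
  ∃ V : Matrix (B × C) A ℂ, Vᴴ * V = 1 ∧
    ∀ X : Matrix A A ℂ, Φ X = traceSnd (V * X * Vᴴ) ∧ Φc X = traceFst (V * X * Vᴴ)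

/-- The von Neumann entropy `S(ρ) = -Tr(ρ log ρ)`; the logarithm is the functional calculus of
`Real.log`, where `Real.log 0 = 0` gives the usual convention `0 log 0 = 0`. -/
def entropy {A : Type} [Fintype A] [DecidableEq A] (ρ : Matrix A A ℂ) : ℝ :=
  -(ρ * cfc Real.log ρ).trace.re

/-- The coherent information `S(Φ(ρ)) - S(Φc(ρ))` of the state `ρ`, where `Φc` is complementary
to `Φ`. -/
def stateCoherentInfo {A B C : Type} [Fintype B] [DecidableEq B] [Fintype C] [DecidableEq C]
    (Φ : Matrix A A ℂ →ₗ[ℂ] Matrix B B ℂ) (Φc : Matrix A A ℂ →ₗ[ℂ] Matrix C C ℂ)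
    (ρ : Matrix A A ℂ) : ℝ :=
  entropy (Φ ρ) - entropy (Φc ρ)

/-- The coherent information `Q^(1)(Φ)` of the channel `Φ`: the maximum of
`S(Φ(ρ)) - S(Φc(ρ))` over the states `ρ`. For a given `ρ` this number is the same for all
channels `Φc` complementary to `Φ`, with any finite environment, so none has to be singled out. -/
def coherentInfo {A B : Type} [Fintype A] [DecidableEq A] [Fintype B] [DecidableEq B]
    (Φ : Matrix A A ℂ →ₗ[ℂ] Matrix B B ℂ) : ℝ :=
  sSup {x : ℝ | ∃ (E : Type) (_ : Fintype E) (_ : DecidableEq E)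
    (Φc : Matrix A A ℂ →ₗ[ℂ] Matrix E E ℂ) (ρ : Matrix A A ℂ),
    IsComplementary Φ Φc ∧ IsState ρ ∧ x = stateCoherentInfo Φ Φc ρ}

/-- `Φ^{⊗n}`, on matrices indexed by `Fin n → A` (the standard basis of `(ℂ^A)^{⊗n}`). It is the
linear extension of `|x₁⟩⟨x'₁| ⊗ ⋯ ⊗ |xₙ⟩⟨x'ₙ| ↦ Φ(|x₁⟩⟨x'₁|) ⊗ ⋯ ⊗ Φ(|xₙ⟩⟨x'ₙ|)`. -/
def tensorPower {A B : Type} [Fintype A] [DecidableEq A]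
    (Φ : Matrix A A ℂ →ₗ[ℂ] Matrix B B ℂ) (n : ℕ) :
    Matrix (Fin n → A) (Fin n → A) ℂ →ₗ[ℂ] Matrix (Fin n → B) (Fin n → B) ℂ where
  toFun X := Matrix.of fun y y' => ∑ x, ∑ x',
    X x x' * ∏ k, Φ (Matrix.single (x k) (x' k) 1) (y k) (y' k)
  map_add' X Y := by
    ext y y'
    simp [add_mul, Finset.sum_add_distrib]
  map_smul' c X := by
    ext y y'
    simp [mul_assoc, Finset.mul_sum]

/-- The quantum capacity, `Q(Φ) = lim_{n → ∞} Q^(1)(Φ^{⊗n}) / n`. -/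
def quantumCapacity {A B : Type} [Fintype A] [DecidableEq A] [Fintype B] [DecidableEq B]
    (Φ : Matrix A A ℂ →ₗ[ℂ] Matrix B B ℂ) : ℝ :=
  Filter.limUnder Filter.atTop fun n : ℕ => coherentInfo (tensorPower Φ n) / n

/-- The matrix of the orthogonal projection of `ℂ^A` onto the kernel of `M`. -/
def kerProj {A : Type} [Fintype A] [DecidableEq A] (M : Matrix A A ℂ) : Matrix A A ℂ :=
  Matrix.toEuclideanLin.symm
    (LinearMap.ker (Matrix.toEuclideanLin M)).starProjection.toLinearMap

end

end QuantumCapacity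

/-! At a pure input `ψ` the two outputs have the same nonzero spectrum (Schmidt decomposition), so
the coherent information is zero there. Replace `ψ` by `(1 - ε)ψ + εσ`. An output entropy then
changes by `ε log (1/ε)` times the weight of the output of `σ` on the kernel of the output of `ψ`,
up to `O(ε)`. The hypothesis says that these coefficients differ, so for small `ε` the logarithm
wins and the coherent information is positive (`exists_entropy_mix_lt`). The upper expansion
`entropy_mix_le` rests on Klein's inequality, the lower one `le_entropy_mix` on operator
monotonicity of the logarithm.

The maximum exists because entropy is continuous on the compact set of states and the environment's
entropy depends on `Φ` and the input only. The limit exists by Fekete's lemma: product inputs give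
superadditivity, and the output dimension gives a linear upper bound. Case (ii) is case (i) with the
two channels exchanged. -/

namespace QuantumCapacity

noncomputable section

/-! ### Entropy as a function of the spectrum. -/

section Spectral

variable {A B : Type} [Fintype A] [DecidableEq A] [Fintype B] [DecidableEq B]

/-- The diagonal entries of `X` in an eigenbasis of the Hermitian matrix `M`. -/
def eigenWeight {M : Matrix A A ℂ} (hM : M.IsHermitian) (X : Matrix A A ℂ) (j : A) : ℝ :=
  ((star (hM.eigenvectorUnitary : Matrix A A ℂ) * X * hM.eigenvectorUnitary) j j).re

variable {M : Matrix A A ℂ} (hM : M.IsHermitian)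

theorem cfc_eq_mul_diagonal (f : ℝ → ℝ) :
    cfc f M = hM.eigenvectorUnitary * Matrix.diagonal (fun j => ((f (hM.eigenvalues j) : ℝ) : ℂ)) *
      star (hM.eigenvectorUnitary : Matrix A A ℂ) := by
  rw [hM.cfc_eq, Matrix.IsHermitian.cfc, Unitary.conjStarAlgAut_apply]
  rfl

theorem re_trace_mul_cfc (X : Matrix A A ℂ) (f : ℝ → ℝ) :
    (X * cfc f M).trace.re = ∑ j, f (hM.eigenvalues j) * eigenWeight hM X j := by
  rw [cfc_eq_mul_diagonal hM, ← mul_assoc, Matrix.trace_mul_comm, ← mul_assoc, ← mul_assoc,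
    Matrix.trace]
  simp only [Matrix.diag_apply, Matrix.mul_diagonal, Complex.re_sum, Complex.re_mul_ofReal,
    eigenWeight]
  exact Finset.sum_congr rfl fun j _ => mul_comm _ _

theorem eigenWeight_nonneg {X : Matrix A A ℂ} (hX : X.PosSemidef) (j : A) :
    0 ≤ eigenWeight hM X j := by
  have h := (hX.conjTranspose_mul_mul_same
    (hM.eigenvectorUnitary : Matrix A A ℂ)).diag_nonneg (i := j)
  exact (Complex.le_def.1 h).1

theorem sum_eigenWeight (X : Matrix A A ℂ) : ∑ j, eigenWeight hM X j = X.trace.re := by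
  have h := re_trace_mul_cfc hM X (fun _ => 1)
  rw [cfc_const_one ℝ M hM.isSelfAdjoint, mul_one] at h
  simp [h]

theorem eigenWeight_self (j : A) : eigenWeight hM M j = hM.eigenvalues j := by
  have h := hM.conjStarAlgAut_star_eigenvectorUnitary
  rw [Unitary.conjStarAlgAut_apply] at h
  simp only [Unitary.coe_star, star_star] at h
  simp [eigenWeight, h]

theorem eigenWeight_add_smul (a b : ℝ) (X Y : Matrix A A ℂ) (j : A) :
    eigenWeight hM (a • X + b • Y) j = a * eigenWeight hM X j + b * eigenWeight hM Y j := by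
  simp [eigenWeight, mul_add, add_mul]

theorem entropy_eq_sum_negMulLog :
    entropy M = ∑ j, Real.negMulLog (hM.eigenvalues j) := by
  rw [entropy, re_trace_mul_cfc hM, ← Finset.sum_neg_distrib]
  refine Finset.sum_congr rfl fun j _ => ?_
  rw [eigenWeight_self, Real.negMulLog]
  ring

theorem entropy_eq_re_trace_cfc (hM : M.IsHermitian) : entropy M = (cfc Real.negMulLog M).trace.re := by
  rw [entropy_eq_sum_negMulLog hM, ← one_mul (cfc _ _), re_trace_mul_cfc hM]
  simp [eigenWeight]

/-- This form makes entropy depend on the characteristic polynomial alone, so that isospectrality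
can be checked without comparing eigenbases. -/
theorem entropy_eq_sum_roots (hM : M.IsHermitian) :
    entropy M = (M.charpoly.roots.map fun z => Real.negMulLog z.re).sum := by
  rw [entropy_eq_sum_negMulLog hM, hM.roots_charpoly_eq_eigenvalues]
  rw [Multiset.map_map]
  rfl

theorem entropy_eq_of_charpoly_eq (hM : M.IsHermitian) {N : Matrix B B ℂ} (hN : N.IsHermitian)
    (h : M.charpoly = N.charpoly) : entropy M = entropy N := by
  rw [entropy_eq_sum_roots hM, entropy_eq_sum_roots hN, h]

theorem sum_eigenvalues_of_trace_eq_one (hM : M.IsHermitian) (h : M.trace = 1) :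
    ∑ i, hM.eigenvalues i = 1 := by
  have h1 := hM.trace_eq_sum_eigenvalues.symm.trans h
  have h2 := congrArg Complex.re h1
  simpa using h2

theorem entropy_transpose (hM : M.IsHermitian) : entropy Mᵀ = entropy M :=
  entropy_eq_of_charpoly_eq hM.transpose hM M.charpoly_transpose

theorem entropy_reindex (e : A ≃ B) (hM : M.IsHermitian) :
    entropy (Matrix.reindex e e M) = entropy M :=
  entropy_eq_of_charpoly_eq (hM.submatrix _) hM (Matrix.charpoly_reindex e M)

/-- The two characteristic polynomials agree up to powers of `X`, and the extra zero roots
contribute `negMulLog 0 = 0`. -/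
theorem entropy_mul_conjTranspose_comm (T : Matrix A B ℂ) :
    entropy (T * Tᴴ) = entropy (Tᴴ * T) := by
  rw [entropy_eq_sum_roots (Matrix.isHermitian_mul_conjTranspose_self T),
    entropy_eq_sum_roots (Matrix.isHermitian_conjTranspose_mul_self T)]
  have h := congrArg (fun p => (p.roots.map fun z : ℂ => Real.negMulLog z.re).sum)
    (Matrix.charpoly_mul_comm' T Tᴴ)
  beta_reduce at h
  rw [Polynomial.roots_mul, Polynomial.roots_mul] at h
  · simpa [Multiset.map_nsmul, Multiset.sum_nsmul] using h
  · exact mul_ne_zero (pow_ne_zero _ Polynomial.X_ne_zero) (Matrix.charpoly_monic _).ne_zero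
  · exact mul_ne_zero (pow_ne_zero _ Polynomial.X_ne_zero) (Matrix.charpoly_monic _).ne_zero

open scoped Kronecker in
-- The eigenvalues are the products `μᵢνⱼ`, and `negMulLog (xy) = y negMulLog x + x negMulLog y`;
-- unit traces remove the spare factors.
theorem entropy_kronecker {N : Matrix B B ℂ} (hM : M.IsHermitian) (hN : N.IsHermitian)
    (hMt : M.trace = 1) (hNt : N.trace = 1) :
    entropy (M ⊗ₖ N) = entropy M + entropy N := by
  have hMN : (M ⊗ₖ N).IsHermitian := by
    rw [Matrix.IsHermitian, Matrix.conjTranspose_kronecker, hM, hN]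
  have hchar : (M ⊗ₖ N).charpoly =
      ∏ p : A × B, (Polynomial.X -
        Polynomial.C ((hM.eigenvalues p.1 * hN.eigenvalues p.2 : ℝ) : ℂ)) := by
    have h1 := hM.spectral_theorem
    have h2 := hN.spectral_theorem
    rw [Unitary.conjStarAlgAut_apply] at h1 h2
    have h3 : (star (hM.eigenvectorUnitary : Matrix A A ℂ) * (hM.eigenvectorUnitary : Matrix A A ℂ)) ⊗ₖ
        (star (hN.eigenvectorUnitary : Matrix B B ℂ) * (hN.eigenvectorUnitary : Matrix B B ℂ)) = 1 := by
      simp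
    conv_lhs => rw [h1, h2]
    rw [Matrix.mul_kronecker_mul, Matrix.charpoly_mul_comm, Matrix.mul_kronecker_mul, ← mul_assoc]
    rw [← Matrix.mul_kronecker_mul, h3, one_mul,
      Matrix.diagonal_kronecker_diagonal, Matrix.charpoly_diagonal]
    simp
  have hs : ∑ i, hM.eigenvalues i = 1 :=
    sum_eigenvalues_of_trace_eq_one hM hMt
  have ht : ∑ i, hN.eigenvalues i = 1 :=
    sum_eigenvalues_of_trace_eq_one hN hNt
  rw [entropy_eq_sum_roots hMN, hchar, Polynomial.roots_prod _ _ (Finset.prod_ne_zero_iff.2 fun p _ =>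
    Polynomial.X_sub_C_ne_zero _)]
  simp only [Polynomial.roots_X_sub_C, Multiset.bind_singleton, Multiset.map_map]
  change ∑ p : A × B, Real.negMulLog (hM.eigenvalues p.1 * hN.eigenvalues p.2) = _
  simp_rw [Real.negMulLog_mul, Finset.sum_add_distrib, Fintype.sum_prod_type, ← Finset.mul_sum,
    ← Finset.sum_mul, hs, ht, one_mul]
  rw [entropy_eq_sum_negMulLog hM, entropy_eq_sum_negMulLog hN]

end Spectral

/-! ### States: entropy bounds, continuity, compactness. -/

section States

open scoped MatrixOrder Matrix.Norms.L2Operator in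
theorem _root_.Matrix.PosSemidef.exists_eq_conjTranspose_mul_self {A : Type} [Fintype A]
    {M : Matrix A A ℂ} (hM : M.PosSemidef) : ∃ W : Matrix A A ℂ, M = Wᴴ * W := by
  classical
  exact CStarAlgebra.nonneg_iff_eq_star_mul_self.1 hM.nonneg

variable {A B : Type} [Fintype A] [DecidableEq A] [Fintype B] [DecidableEq B] {ρ : Matrix A A ℂ}

theorem IsState.sum_eigenvalues (hρ : IsState ρ) : ∑ i, hρ.1.1.eigenvalues i = 1 :=
  sum_eigenvalues_of_trace_eq_one hρ.1.1 hρ.2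

theorem IsState.eigenvalues_le_one (hρ : IsState ρ) (i : A) : hρ.1.1.eigenvalues i ≤ 1 := by
  rw [← hρ.sum_eigenvalues]
  exact Finset.single_le_sum (fun j _ => hρ.1.eigenvalues_nonneg j) (Finset.mem_univ i)

omit [DecidableEq A] in
theorem IsState.nonempty (hρ : IsState ρ) : Nonempty A := by
  by_contra h
  rw [not_nonempty_iff] at h
  simpa [Matrix.trace] using hρ.2

theorem IsState.spectrum_subset (hρ : IsState ρ) : spectrum ℝ ρ ⊆ Set.Icc 0 1 := by
  rw [hρ.1.1.spectrum_real_eq_range_eigenvalues]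
  rintro _ ⟨i, rfl⟩
  exact ⟨hρ.1.eigenvalues_nonneg i, hρ.eigenvalues_le_one i⟩

theorem IsState.entropy_nonneg (hρ : IsState ρ) : 0 ≤ entropy ρ := by
  rw [entropy_eq_sum_negMulLog hρ.1.1]
  exact Finset.sum_nonneg fun i _ =>
    Real.negMulLog_nonneg (hρ.1.eigenvalues_nonneg i) (hρ.eigenvalues_le_one i)

theorem IsState.entropy_le_log_card (hρ : IsState ρ) :
    entropy ρ ≤ Real.log (Fintype.card A) := by
  have := hρ.nonempty
  have hn : (0 : ℝ) < Fintype.card A := by exact_mod_cast Fintype.card_pos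
  rw [entropy_eq_sum_negMulLog hρ.1.1]
  -- Tangent line of `negMulLog` at `1 / card A`; the correction terms sum to zero.
  have key : ∀ i, Real.negMulLog (hρ.1.1.eigenvalues i) ≤
      hρ.1.1.eigenvalues i * Real.log (Fintype.card A) +
        ((Fintype.card A : ℝ)⁻¹ - hρ.1.1.eigenvalues i) := by
    intro i
    rcases (hρ.1.eigenvalues_nonneg i).eq_or_lt with h | h
    · rw [← h]; simp
    · have h1 := Real.negMulLog_le_one_sub_self (mul_nonneg hn.le h.le)
      rw [Real.negMulLog, Real.log_mul hn.ne' h.ne'] at h1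
      rw [Real.negMulLog]
      have h2 := mul_le_mul_of_nonneg_left h1 (inv_nonneg.2 hn.le)
      have h3 : (Fintype.card A : ℝ)⁻¹ * Fintype.card A = 1 := inv_mul_cancel₀ hn.ne'
      calc _ = (Fintype.card A : ℝ)⁻¹ * (-(Fintype.card A * hρ.1.1.eigenvalues i) *
          (Real.log (Fintype.card A) + Real.log (hρ.1.1.eigenvalues i))) +
          hρ.1.1.eigenvalues i * Real.log (Fintype.card A) := by
            linear_combination (-hρ.1.1.eigenvalues i *
              (Real.log (Fintype.card A) + Real.log (hρ.1.1.eigenvalues i))) * (-h3)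
        _ ≤ _ := by
            have h4 : (Fintype.card A : ℝ)⁻¹ * (1 - Fintype.card A * hρ.1.1.eigenvalues i) =
              (Fintype.card A : ℝ)⁻¹ - hρ.1.1.eigenvalues i := by
                linear_combination (-hρ.1.1.eigenvalues i) * h3
            linarith
  refine (Finset.sum_le_sum fun i _ => key i).trans ?_
  rw [Finset.sum_add_distrib, ← Finset.sum_mul, Finset.sum_sub_distrib, hρ.sum_eigenvalues]
  simp

open scoped Matrix.Norms.L2Operator in
-- All spectra lie in the fixed compact set `[0, 1]`, on which the functional calculus of a
-- continuous function is continuous in the matrix.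
theorem continuousOn_entropy : ContinuousOn (entropy : Matrix A A ℂ → ℝ) {ρ | IsState ρ} := by
  have h : ContinuousOn (fun ρ : Matrix A A ℂ => (cfc Real.negMulLog ρ).trace.re)
      {ρ | IsState ρ} := by
    have h1 : ContinuousOn (cfc Real.negMulLog : Matrix A A ℂ → Matrix A A ℂ)
        {ρ | IsState ρ} :=
      (continuousOn_cfc (Matrix A A ℂ) (isCompact_Icc (a := (0 : ℝ)) (b := 1)) Real.negMulLog
        Real.continuous_negMulLog.continuousOn).mono
        fun ρ hρ => ⟨hρ.1.1.isSelfAdjoint, hρ.spectrum_subset⟩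
    have h2 : Continuous fun X : Matrix A A ℂ => X.trace.re := by fun_prop
    exact h2.comp_continuousOn h1
  exact h.congr fun ρ hρ => entropy_eq_re_trace_cfc hρ.1.1

omit [DecidableEq A] in
-- States are the image of the Frobenius unit sphere under `W ↦ Wᴴ * W`.
theorem isCompact_setOf_isState : IsCompact {ρ : Matrix A A ℂ | IsState ρ} := by
  have hc : IsCompact {W : A → A → ℂ | ∑ i, ∑ j, Complex.normSq (W i j) = 1} := by
    refine (isCompact_univ_pi fun _ : A => isCompact_univ_pi fun _ : A =>
      isCompact_closedBall (0 : ℂ) 1).of_isClosed_subset ?_ ?_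
    · refine isClosed_eq ?_ continuous_const
      have := Complex.continuous_normSq
      fun_prop
    · intro W hW i _ j _
      have h1 : Complex.normSq (W i j) ≤ 1 := by
        rw [← (show ∑ i, ∑ j, Complex.normSq (W i j) = 1 from hW)]
        exact (Finset.single_le_sum (f := fun j => Complex.normSq (W i j))
          (fun j _ => Complex.normSq_nonneg _) (Finset.mem_univ j)).trans
          (Finset.single_le_sum (f := fun i => ∑ j, Complex.normSq (W i j))
            (fun i _ => Finset.sum_nonneg fun j _ => Complex.normSq_nonneg _)
            (Finset.mem_univ i))
      rw [Complex.normSq_eq_norm_sq] at h1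
      rw [mem_closedBall_zero_iff]
      exact (sq_le_one_iff₀ (norm_nonneg _)).1 h1
  have htr : ∀ W : Matrix A A ℂ, (Wᴴ * W).trace =
      ((∑ i, ∑ j, Complex.normSq (W i j) : ℝ) : ℂ) := by
    intro W
    rw [Matrix.trace, Finset.sum_comm]
    simp [Matrix.mul_apply, Complex.normSq_eq_conj_mul_self]
  have hcont : Continuous fun W : Matrix A A ℂ => Wᴴ * W := by fun_prop
  convert hc.image hcont using 1
  ext ρ
  constructor
  · rintro ⟨h1, h2⟩
    obtain ⟨W, rfl⟩ := h1.exists_eq_conjTranspose_mul_self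
    refine ⟨W, ?_, rfl⟩
    rw [htr] at h2
    exact_mod_cast h2
  · rintro ⟨W, hW, rfl⟩
    refine ⟨Matrix.posSemidef_conjTranspose_mul_self W, ?_⟩
    exact (htr W).trans (by rw [show ∑ i, ∑ j, Complex.normSq (W i j) = 1 from hW, Complex.ofReal_one])

end States

/-! ### The kernel projection as a spectral projection. -/

section KernelProjection

variable {A : Type} [Fintype A] [DecidableEq A] {M : Matrix A A ℂ}

theorem continuousOn_spectrum (hM : M.IsHermitian) (f : ℝ → ℝ) :
    ContinuousOn f (spectrum ℝ M) :=
  (hM.spectrum_real_eq_range_eigenvalues ▸ Set.finite_range _).continuousOn f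

theorem cfc_mul_cfc (hM : M.IsHermitian) (f g : ℝ → ℝ) :
    cfc f M * cfc g M = cfc (fun x => f x * g x) M :=
  (cfc_mul f g M (continuousOn_spectrum hM f) (continuousOn_spectrum hM g)).symm

/-- Let `P` be the right-hand side. Its range lies in the kernel since `M * P = 0`. With `0⁻¹ = 0`,
`1 - P` is `M` times the functional calculus of the inverse, so its range lies in that of `M`,
orthogonal to the kernel. -/
theorem kerProj_eq_cfc (hM : M.IsHermitian) :
    kerProj M = cfc (fun x : ℝ => if x = 0 then (1 : ℝ) else 0) M := by
  set P := cfc (fun x : ℝ => if x = 0 then (1 : ℝ) else 0) M with hP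
  have hid : cfc (fun x : ℝ => x) M = M := cfc_id' ℝ M hM.isSelfAdjoint
  have hMP : M * P = 0 := by
    have h : cfc (fun x : ℝ => x) M * P = 0 := by
      rw [hP, cfc_mul_cfc hM]
      have : (fun x : ℝ => x * if x = 0 then (1 : ℝ) else 0) = fun _ => 0 := by
        ext x
        by_cases hx : x = 0 <;> simp [hx]
      rw [this, cfc_const_zero]
    rwa [hid] at h
  have hQ : M * cfc (fun x : ℝ => x⁻¹) M = 1 - P := by
    have h : cfc (fun x : ℝ => x) M * cfc (fun x : ℝ => x⁻¹) M = 1 - P := by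
      rw [hP, cfc_mul_cfc hM, ← cfc_one ℝ M hM.isSelfAdjoint,
        ← cfc_sub _ _ M (continuousOn_spectrum hM _) (continuousOn_spectrum hM _)]
      congr 1
      ext x
      by_cases hx : x = 0 <;> simp [hx]
    rwa [hid] at h
  rw [kerProj, LinearEquiv.symm_apply_eq]
  ext1 v
  refine Submodule.eq_starProjection_of_mem_of_inner_eq_zero ?_ ?_
  · have h := LinearMap.congr_fun (Matrix.toLpLin_mul_same 2 M P) v
    rw [hMP, map_zero] at h
    exact h.symm
  · intro w hw
    have h := LinearMap.congr_fun (Matrix.toLpLin_mul_same 2 M (cfc (fun x : ℝ => x⁻¹) M)) v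
    rw [hQ, map_sub, Matrix.toLpLin_one] at h
    have h' : v - Matrix.toEuclideanLin P v =
      Matrix.toEuclideanLin M (Matrix.toEuclideanLin (cfc (fun x : ℝ => x⁻¹) M) v) := h
    rw [h', (Matrix.isSymmetric_toEuclideanLin_iff.2 hM), LinearMap.mem_ker.1 hw, inner_zero_right]

theorem re_trace_kerProj_mul (hM : M.IsHermitian) (X : Matrix A A ℂ) :
    (kerProj M * X).trace.re =
      ∑ j, (if hM.eigenvalues j = 0 then 1 else 0) * eigenWeight hM X j := by
  rw [Matrix.trace_mul_comm, kerProj_eq_cfc hM, re_trace_mul_cfc hM]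

end KernelProjection

/-! ### Upper and lower bounds on entropy by a reference operator. -/

section EntropyBounds

variable {A : Type} [Fintype A] [DecidableEq A] {M ρ : Matrix A A ℂ}

theorem negMulLog_le_tangent {x s : ℝ} (hx : 0 ≤ x) (hs : 0 < s) :
    Real.negMulLog x ≤ -(x * Real.log s) + (s - x) := by
  rcases hx.eq_or_lt with rfl | hx
  · simpa using hs.le
  · have h := mul_le_mul_of_nonneg_left
      (Real.negMulLog_le_one_sub_self (div_nonneg hx.le hs.le)) hs.le
    rw [Real.negMulLog, Real.log_div hx.ne' hs.ne'] at h
    have h1 : s * (x / s) = x := mul_div_cancel₀ x hs.ne'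
    rw [Real.negMulLog]
    have h2 : s * (-(x / s) * (Real.log x - Real.log s)) = -x * Real.log x + x * Real.log s := by
      linear_combination (-(Real.log x - Real.log s)) * h1
    have h3 : s * (1 - x / s) = s - x := by linear_combination -h1
    linarith

/-- Klein's inequality for the positive definite operator `M + t`. -/
theorem entropy_le_cross_entropy (hM : M.PosSemidef) (hρ : ρ.PosSemidef) {t : ℝ} (ht : 0 < t) :
    entropy ρ ≤ -(∑ j, Real.log (hM.1.eigenvalues j + t) * eigenWeight hM.1 ρ j) +
      (M.trace.re + t * Fintype.card A - ρ.trace.re) := by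
  set N : Matrix A A ℂ := star (hρ.1.eigenvectorUnitary : Matrix A A ℂ) *
    (hM.1.eigenvectorUnitary : Matrix A A ℂ) with hN
  have hN1 : star N * N = 1 := by
    rw [hN, star_mul, star_star, mul_assoc, ← mul_assoc (hρ.1.eigenvectorUnitary : Matrix A A ℂ)]
    simp
  have hN2 : N * star N = 1 := mul_eq_one_comm.1 hN1
  -- Squared overlaps of the two eigenbases. They form a doubly stochastic matrix, which reduces the
  -- claim to the scalar tangent inequality.
  set p : A → A → ℝ := fun i j => Complex.normSq (N i j) with hp
  have hcol : ∀ j, ∑ i, p i j = 1 := by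
    intro j
    have h := congrArg Complex.re (congrFun (congrFun hN1 j) j)
    simpa [Matrix.mul_apply, Matrix.star_apply, hp, Complex.normSq_apply] using h
  have hrow : ∀ i, ∑ j, p i j = 1 := by
    intro i
    have h := congrArg Complex.re (congrFun (congrFun hN2 i) i)
    simpa [Matrix.mul_apply, Matrix.star_apply, hp, Complex.normSq_apply] using h
  have hw : ∀ j, eigenWeight hM.1 ρ j = ∑ i, p i j * hρ.1.eigenvalues i := by
    intro j
    have h1 := hρ.1.spectral_theorem
    rw [Unitary.conjStarAlgAut_apply] at h1
    have h2 : star (hM.1.eigenvectorUnitary : Matrix A A ℂ) * ρ *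
        (hM.1.eigenvectorUnitary : Matrix A A ℂ) =
        star N * (Matrix.diagonal (RCLike.ofReal ∘ hρ.1.eigenvalues) * N) := by
      conv_lhs => rw [h1]
      simp only [hN, star_mul, star_star, mul_assoc]
    rw [eigenWeight, h2, Matrix.mul_apply, Complex.re_sum]
    refine Finset.sum_congr rfl fun i _ => ?_
    simp [Matrix.diagonal_mul, Matrix.star_apply, hp, Complex.normSq_apply]
    ring
  have h1 : ∑ j, hM.1.eigenvalues j = M.trace.re := by
    rw [← sum_eigenWeight hM.1]; simp [eigenWeight_self]
  have h2 : ∑ j, hρ.1.eigenvalues j = ρ.trace.re := by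
    rw [← sum_eigenWeight hρ.1]; simp [eigenWeight_self]
  calc entropy ρ = ∑ i, ∑ j, p i j * Real.negMulLog (hρ.1.eigenvalues i) := by
        rw [entropy_eq_sum_negMulLog hρ.1]
        simp_rw [← Finset.sum_mul, hrow, one_mul]
    _ ≤ ∑ i, ∑ j, p i j * (-(hρ.1.eigenvalues i * Real.log (hM.1.eigenvalues j + t)) +
          (hM.1.eigenvalues j + t - hρ.1.eigenvalues i)) := by
        refine Finset.sum_le_sum fun i _ => Finset.sum_le_sum fun j _ => ?_
        exact mul_le_mul_of_nonneg_left (negMulLog_le_tangent (hρ.eigenvalues_nonneg i)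
          (add_pos_of_nonneg_of_pos (hM.eigenvalues_nonneg j) ht)) (Complex.normSq_nonneg _)
    _ = -(∑ j, Real.log (hM.1.eigenvalues j + t) * ∑ i, p i j * hρ.1.eigenvalues i) +
          (∑ j, (∑ i, p i j) * (hM.1.eigenvalues j + t) -
            ∑ i, (∑ j, p i j) * hρ.1.eigenvalues i) := by
        simp_rw [mul_add, mul_sub, Finset.sum_add_distrib, Finset.sum_sub_distrib, Finset.mul_sum,
          Finset.sum_mul, mul_add, Finset.sum_add_distrib]
        rw [Finset.sum_comm (f := fun i j => p i j * hM.1.eigenvalues j),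
          Finset.sum_comm (f := fun i j => p i j * t),
          Finset.sum_comm (f := fun i j => p i j *
            -(hρ.1.eigenvalues i * Real.log (hM.1.eigenvalues j + t))),
          ← Finset.sum_neg_distrib]
        congr 1
        refine Finset.sum_congr rfl fun j _ => ?_
        rw [← Finset.sum_neg_distrib]
        exact Finset.sum_congr rfl fun i _ => by ring
    _ = _ := by
        simp_rw [hcol, hrow, hw, one_mul, Finset.sum_add_distrib, h1, h2]
        rw [Finset.sum_const, Finset.card_univ, nsmul_eq_mul, mul_comm t]

omit [DecidableEq A] in
theorem re_trace_mul_nonneg {X Y : Matrix A A ℂ} (hX : X.PosSemidef) (hY : Y.PosSemidef) :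
    0 ≤ (X * Y).trace.re := by
  obtain ⟨W, rfl⟩ := hX.exists_eq_conjTranspose_mul_self
  rw [mul_assoc, Matrix.trace_mul_comm]
  exact (Complex.le_def.1 (hY.mul_mul_conjTranspose_same W).trace_nonneg).1

open scoped Matrix.Norms.L2Operator in
theorem log_add_algebraMap (hM : M.PosSemidef) (t : ℝ) :
    CFC.log (M + algebraMap ℝ _ t) = cfc (fun x => Real.log (x + t)) M := by
  have h : M + algebraMap ℝ _ t = cfc (fun x : ℝ => x + t) M := by
    rw [cfc_add_const _ _ _ (by fun_prop) hM.1.isSelfAdjoint, cfc_id' ℝ M hM.1.isSelfAdjoint]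
  rw [h, CFC.log, ← cfc_comp' Real.log (fun x : ℝ => x + t) M ?_ (by fun_prop) hM.1.isSelfAdjoint]
  exact ((hM.1.spectrum_real_eq_range_eigenvalues ▸ Set.finite_range _).image _).continuousOn _

open scoped MatrixOrder Matrix.Norms.L2Operator in
-- Operator monotonicity of the logarithm, paired with `ρ`, bounds `Tr ρ log (ρ + t)`, which is at
-- least `Tr ρ log ρ`. The shifts make both operators strictly positive.
theorem neg_entropy_le_of_posSemidef_sub (hM : M.PosSemidef) (hρ : ρ.PosSemidef) {s t : ℝ}
    (hs : 0 < s) (ht : 0 < t)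
    (h : (M + algebraMap ℝ _ s - (ρ + algebraMap ℝ _ t)).PosSemidef) :
    -entropy ρ ≤ ∑ j, Real.log (hM.1.eigenvalues j + s) * eigenWeight hM.1 ρ j := by
  have hpos : ∀ {N : Matrix A A ℂ} {r : ℝ}, N.PosSemidef → 0 < r →
      IsStrictlyPositive (N + algebraMap ℝ (Matrix A A ℂ) r) := by
    intro N r hN hr
    rw [Matrix.isStrictlyPositive_iff_posDef]
    refine Matrix.PosDef.posSemidef_add hN ?_
    rw [Algebra.algebraMap_eq_smul_one]
    exact Matrix.PosDef.one.smul hr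
  have hlog := CFC.log_monotoneOn (hpos hρ ht) (hpos hM hs) (Matrix.le_iff.2 h)
  rw [log_add_algebraMap hρ, log_add_algebraMap hM] at hlog
  have h1 := re_trace_mul_nonneg hρ (Matrix.le_iff.1 hlog)
  rw [mul_sub, Matrix.trace_sub, Complex.sub_re, re_trace_mul_cfc hM.1,
    re_trace_mul_cfc hρ.1] at h1
  refine le_trans ?_ (sub_nonneg.1 h1)
  rw [entropy_eq_sum_negMulLog hρ.1, ← Finset.sum_neg_distrib]
  refine Finset.sum_le_sum fun i _ => ?_
  rw [eigenWeight_self, Real.negMulLog]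
  rcases (hρ.eigenvalues_nonneg i).eq_or_lt with h0 | h0
  · simp [← h0]
  · have := Real.log_le_log h0 (le_add_of_nonneg_right ht.le)
    nlinarith

end EntropyBounds

/-! ### Entropy of a slightly mixed state, to order `ε log ε`. -/

section Mixtures

variable {A : Type} [Fintype A] [DecidableEq A] {ρ σ : Matrix A A ℂ}

omit [DecidableEq A] in
theorem IsState.mix (hρ : IsState ρ) (hσ : IsState σ) {ε : ℝ} (h0 : 0 ≤ ε) (h1 : ε ≤ 1) :
    IsState ((1 - ε) • ρ + ε • σ) := by
  refine ⟨(hρ.1.smul (sub_nonneg.2 h1)).add (hσ.1.smul h0), ?_⟩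
  rw [Matrix.trace_add, Matrix.trace_smul, Matrix.trace_smul, hρ.2, hσ.2, ← add_smul]
  simp

theorem IsState.posSemidef_one_sub (hρ : IsState ρ) : (1 - ρ).PosSemidef := by
  have hid : cfc (fun x : ℝ => x) ρ = ρ := cfc_id' ℝ ρ hρ.1.1.isSelfAdjoint
  have h : 1 - ρ = cfc (fun x : ℝ => 1 - x) ρ := by
    rw [cfc_sub _ _ ρ (by fun_prop) (by fun_prop), hid, cfc_const_one ℝ ρ hρ.1.1.isSelfAdjoint]
  rw [h, cfc_eq_mul_diagonal hρ.1.1]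
  refine (Matrix.PosSemidef.diagonal fun j => ?_).mul_mul_conjTranspose_same
    (hρ.1.1.eigenvectorUnitary : Matrix A A ℂ)
  rw [Pi.zero_apply]
  exact Complex.zero_le_real.2 <| sub_nonneg.2 (hρ.eigenvalues_le_one j)

theorem sum_log_mul_eigenWeight_mix (hρ : IsState ρ) (ε s : ℝ) :
    ∑ j, Real.log (hρ.1.1.eigenvalues j + s) * eigenWeight hρ.1.1 ((1 - ε) • ρ + ε • σ) j =
      (1 - ε) * ∑ j, hρ.1.1.eigenvalues j * Real.log (hρ.1.1.eigenvalues j + s) +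
      ε * ∑ j, Real.log (hρ.1.1.eigenvalues j + s) * eigenWeight hρ.1.1 σ j := by
  simp_rw [eigenWeight_add_smul, eigenWeight_self, mul_add, Finset.sum_add_distrib, Finset.mul_sum]
  congr 1 <;> exact Finset.sum_congr rfl fun j _ => by ring

/-- Klein's inequality with reference `ρ + ε`: kernel directions of `ρ` carry `log ε`, and the
others stay bounded. -/
theorem entropy_mix_le (hρ : IsState ρ) (hσ : IsState σ) :
    ∃ C : ℝ, ∀ ε : ℝ, 0 < ε → ε ≤ 1 → entropy ((1 - ε) • ρ + ε • σ) ≤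
      entropy ρ - ε * Real.log ε * (kerProj ρ * σ).trace.re + C * ε := by
  set μ := hρ.1.1.eigenvalues with hμ
  set w := eigenWeight hρ.1.1 σ with hw
  -- The terms come from the trace of the shift, the factor `1 - ε` on the entropy of `ρ`, and the
  -- nonzero eigenvalues; `Real.log 0 = 0` drops the kernel.
  refine ⟨Fintype.card A - entropy ρ - ∑ j, Real.log (μ j) * w j, fun ε h0 h1 => ?_⟩
  have hmix := hρ.mix hσ h0.le h1
  have hK := entropy_le_cross_entropy hρ.1 hmix.1 h0
  rw [sum_log_mul_eigenWeight_mix hρ, hmix.2] at hK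
  have htr : ρ.trace.re = 1 := by rw [hρ.2, Complex.one_re]
  have hμ0 : ∀ j, 0 ≤ μ j := hρ.1.eigenvalues_nonneg
  have hA : -entropy ρ ≤ ∑ j, μ j * Real.log (μ j + ε) := by
    rw [entropy_eq_sum_negMulLog hρ.1.1, ← Finset.sum_neg_distrib]
    refine Finset.sum_le_sum fun j _ => ?_
    rw [Real.negMulLog, ← hμ]
    rcases (hμ0 j).eq_or_lt with h | h
    · simp [← h]
    · have := mul_le_mul_of_nonneg_left (Real.log_le_log h (le_add_of_nonneg_right h0.le)) h.le
      linarith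
  have hB : Real.log ε * (kerProj ρ * σ).trace.re + ∑ j, Real.log (μ j) * w j ≤
      ∑ j, Real.log (μ j + ε) * w j := by
    rw [re_trace_kerProj_mul hρ.1.1, Finset.mul_sum, ← Finset.sum_add_distrib]
    refine Finset.sum_le_sum fun j _ => ?_
    rw [← hμ, ← hw]
    have hwj : 0 ≤ w j := eigenWeight_nonneg hρ.1.1 hσ.1 j
    rcases (hμ0 j).eq_or_lt with h | h
    · simp [← h]
    · simp only [h.ne', if_false, zero_mul, mul_zero, zero_add]
      exact mul_le_mul_of_nonneg_right (Real.log_le_log h (le_add_of_nonneg_right h0.le)) hwj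
  have hA' := mul_le_mul_of_nonneg_left hA (sub_nonneg.2 h1)
  have hB' := mul_le_mul_of_nonneg_left hB h0.le
  simp only [Complex.one_re] at hK
  linarith

theorem le_entropy_mix (hρ : IsState ρ) (hσ : IsState σ) :
    ∃ C : ℝ, ∀ ε : ℝ, 0 < ε → ε ≤ 1 →
      entropy ρ - ε * Real.log ε * (kerProj ρ * σ).trace.re - C * ε ≤
        entropy ((1 - ε) • ρ + ε • σ) := by
  set μ := hρ.1.1.eigenvalues with hμ
  set w := eigenWeight hρ.1.1 σ with hw
  refine ⟨entropy ρ + 2 * Fintype.card A + 2, fun ε h0 h1 => ?_⟩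
  have hmix := hρ.mix hσ h0.le h1
  have hμ0 : ∀ j, 0 ≤ μ j := hρ.1.eigenvalues_nonneg
  have hμ1 : ∀ j, μ j ≤ 1 := hρ.eigenvalues_le_one
  -- The difference is `ερ + ε(1 - σ)`; the shift `2ε` on the left is what absorbs `εσ`.
  have hpos : (ρ + algebraMap ℝ _ (2 * ε) -
      ((1 - ε) • ρ + ε • σ + algebraMap ℝ _ ε)).PosSemidef := by
    convert (hρ.1.smul h0.le).add (hσ.posSemidef_one_sub.smul h0.le) using 1
    simp only [Algebra.algebraMap_eq_smul_one]
    module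
  have hK := neg_entropy_le_of_posSemidef_sub hρ.1 hmix.1 (mul_pos two_pos h0) h0 hpos
  rw [sum_log_mul_eigenWeight_mix hρ] at hK
  have hA : ∑ j, μ j * Real.log (μ j + 2 * ε) ≤ -entropy ρ + 2 * ε * Fintype.card A := by
    have h2 : 2 * ε * Fintype.card A = ∑ _j : A, 2 * ε := by
      rw [Finset.sum_const, Finset.card_univ, nsmul_eq_mul, mul_comm]
    rw [entropy_eq_sum_negMulLog hρ.1.1, ← Finset.sum_neg_distrib, h2, ← Finset.sum_add_distrib]
    refine Finset.sum_le_sum fun j _ => ?_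
    rw [Real.negMulLog, ← hμ]
    rcases (hμ0 j).eq_or_lt with h | h
    · simp [← h, h0.le]
    · have h3 : Real.log (μ j + 2 * ε) = Real.log (μ j) + Real.log (1 + 2 * ε / μ j) := by
        rw [← Real.log_mul h.ne' (by positivity)]
        congr 1
        field_simp
      have h4 := Real.log_le_sub_one_of_pos (show 0 < 1 + 2 * ε / μ j by positivity)
      have h5 := mul_le_mul_of_nonneg_left h4 h.le
      have h6 : μ j * (1 + 2 * ε / μ j - 1) = 2 * ε := by field_simp; ring
      rw [h3]
      linarith
  have hB : ∑ j, Real.log (μ j + 2 * ε) * w j ≤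
      Real.log ε * (kerProj ρ * σ).trace.re + 2 := by
    have h2 : (2 : ℝ) = ∑ j, 2 * w j := by
      rw [← Finset.mul_sum, hw, sum_eigenWeight, hσ.2]
      simp
    conv_rhs => rw [h2]
    rw [re_trace_kerProj_mul hρ.1.1, Finset.mul_sum, ← Finset.sum_add_distrib]
    refine Finset.sum_le_sum fun j _ => ?_
    rw [← hμ, ← hw]
    have hwj : 0 ≤ w j := eigenWeight_nonneg hρ.1.1 hσ.1 j
    rcases (hμ0 j).eq_or_lt with h | h
    · have h3 := Real.log_le_sub_one_of_pos (show (0 : ℝ) < 2 by norm_num)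
      simp only [← h, if_true, one_mul, zero_add, Real.log_mul two_ne_zero h0.ne']
      nlinarith
    · simp only [h.ne', if_false, zero_mul, mul_zero, zero_add]
      have h3 := Real.log_le_sub_one_of_pos (show 0 < μ j + 2 * ε by positivity)
      have := hμ1 j
      exact mul_le_mul_of_nonneg_right (by linarith) hwj
  have hA' := mul_le_mul_of_nonneg_left hA (sub_nonneg.2 h1)
  have hB' := mul_le_mul_of_nonneg_left hB h0.le
  have h7 : 0 ≤ ε * ε * Fintype.card A := by positivity
  linarith

/-- If `σ` has more weight on the kernel of `ρ` than `σ'` on that of `ρ'`, then the entropy of a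
slight mixture with `σ` exceeds that of the same mixture with `σ'`, since the two weights are the
coefficients of the dominating term `ε log (1 / ε)`. -/
theorem exists_entropy_mix_lt {B : Type} [Fintype B] [DecidableEq B] {ρ' σ' : Matrix B B ℂ}
    (hρ : IsState ρ) (hσ : IsState σ) (hρ' : IsState ρ') (hσ' : IsState σ')
    (heq : entropy ρ = entropy ρ')
    (hlt : (kerProj ρ' * σ').trace.re < (kerProj ρ * σ).trace.re) :
    ∃ ε : ℝ, 0 < ε ∧ ε ≤ 1 ∧
      entropy ((1 - ε) • ρ' + ε • σ') < entropy ((1 - ε) • ρ + ε • σ) := by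
  obtain ⟨C, hC⟩ := le_entropy_mix hρ hσ
  obtain ⟨C', hC'⟩ := entropy_mix_le hρ' hσ'
  set δ := (kerProj ρ * σ).trace.re - (kerProj ρ' * σ').trace.re with hδ
  have hδ0 : 0 < δ := sub_pos.2 hlt
  -- With `ε = exp (-K)`, the gain `-δ log ε = Kδ` exceeds both error constants; the maximum with
  -- `0` keeps `ε ≤ 1`.
  set K := max 0 ((C + C' + 1) / δ) with hKdef
  have hKδ : C + C' + 1 ≤ K * δ := (div_le_iff₀ hδ0).1 (le_max_right _ _)
  refine ⟨Real.exp (-K), Real.exp_pos _, Real.exp_le_one_iff.2 (neg_nonpos.2 (le_max_left _ _)),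
    ?_⟩
  set ε := Real.exp (-K) with hε
  have h0 : 0 < ε := Real.exp_pos _
  have h1 : ε ≤ 1 := Real.exp_le_one_iff.2 (neg_nonpos.2 (le_max_left _ _))
  have hlog : Real.log ε = -K := Real.log_exp _
  have hlow := hC ε h0 h1
  have hup := hC' ε h0 h1
  rw [hlog] at hlow hup
  have := mul_le_mul_of_nonneg_left hKδ h0.le
  rw [hδ] at this
  linarith

end Mixtures

/-! ### Complementary channels and the one-shot coherent information. -/

section Complementary

variable {A B C : Type} [Fintype A] [DecidableEq A] [Fintype B] [Fintype C]
  {Φ : Matrix A A ℂ →ₗ[ℂ] Matrix B B ℂ} {Φc : Matrix A A ℂ →ₗ[ℂ] Matrix C C ℂ}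
  {ρ : Matrix A A ℂ}

theorem IsComplementary.symm (h : IsComplementary Φ Φc) : IsComplementary Φc Φ := by
  obtain ⟨V, hV, hVX⟩ := h
  refine ⟨V.submatrix (Equiv.prodComm C B) id, ?_, fun X => ?_⟩
  · rw [Matrix.conjTranspose_submatrix, Matrix.submatrix_mul_equiv, hV, Matrix.submatrix_id_id]
  · have h : V.submatrix (Equiv.prodComm C B) id * X *
        (V.submatrix (Equiv.prodComm C B) id)ᴴ =
        (V * X * Vᴴ).submatrix (Equiv.prodComm C B) (Equiv.prodComm C B) := rfl
    rw [h, (hVX X).1, (hVX X).2]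
    exact ⟨rfl, rfl⟩

omit [DecidableEq A] [Fintype B] in
theorem traceSnd_mul_conjTranspose (Y : Matrix (B × C) A ℂ) :
    traceSnd (Y * Yᴴ) = (Matrix.of fun b (p : C × A) => Y (b, p.1) p.2) *
      (Matrix.of fun b (p : C × A) => Y (b, p.1) p.2)ᴴ := by
  ext i j
  simp [traceSnd, Matrix.mul_apply, Fintype.sum_prod_type]

omit [DecidableEq A] [Fintype C] in
theorem traceFst_mul_conjTranspose (Y : Matrix (B × C) A ℂ) :
    traceFst (Y * Yᴴ) = (Matrix.of fun c (p : B × A) => Y (p.1, c) p.2) *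
      (Matrix.of fun c (p : B × A) => Y (p.1, c) p.2)ᴴ := by
  ext i j
  simp [traceFst, Matrix.mul_apply, Fintype.sum_prod_type]

omit [DecidableEq A] [Fintype B] [Fintype C] in
theorem mul_conjTranspose_mul_self_mul (V : Matrix B A ℂ) (W : Matrix A A ℂ) :
    V * (Wᴴ * W) * Vᴴ = (V * Wᴴ) * (V * Wᴴ)ᴴ := by
  rw [Matrix.conjTranspose_mul, Matrix.conjTranspose_conjTranspose]
  simp only [Matrix.mul_assoc]

theorem IsComplementary.isState (h : IsComplementary Φ Φc) (hρ : IsState ρ) : IsState (Φ ρ) := by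
  obtain ⟨V, hV, hVX⟩ := h
  obtain ⟨W, hW⟩ := hρ.1.exists_eq_conjTranspose_mul_self
  constructor
  · rw [(hVX ρ).1, hW, mul_conjTranspose_mul_self_mul, traceSnd_mul_conjTranspose]
    exact Matrix.posSemidef_self_mul_conjTranspose _
  · have h1 : (traceSnd (V * ρ * Vᴴ)).trace = (V * ρ * Vᴴ).trace := by
      simp [traceSnd, Matrix.trace, Fintype.sum_prod_type]
    rw [(hVX ρ).1, h1, Matrix.trace_mul_comm, ← Matrix.mul_assoc, hV, Matrix.one_mul, hρ.2]

/-- The Gram matrix of the vectors whose span carries the output `Φc (Wᴴ * W)` of a channel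
complementary to `Φ`; it depends on `Φ` only. -/
def complementGram (Φ : Matrix A A ℂ →ₗ[ℂ] Matrix B B ℂ) (W : Matrix A A ℂ) :
    Matrix (B × A) (B × A) ℂ :=
  Matrix.of fun p q => Φ (Wᴴ * Matrix.single q.2 p.2 1 * W) q.1 p.1

variable [DecidableEq B] [DecidableEq C]

/-- The environment output is `T * Tᴴ`, where `T` is `V * Wᴴ` with all indices but the environment's
moved to the columns. The entries of `Tᴴ * T` already trace out the environment, so `Φ` determines
them. -/
theorem IsComplementary.entropy_eq (h : IsComplementary Φ Φc) (W : Matrix A A ℂ) :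
    entropy (Φc (Wᴴ * W)) = entropy (complementGram Φ W) := by
  obtain ⟨V, hV, hVX⟩ := h
  rw [(hVX _).2, mul_conjTranspose_mul_self_mul, traceFst_mul_conjTranspose,
    entropy_mul_conjTranspose_comm]
  congr 1
  ext ⟨b, a⟩ ⟨b', a'⟩
  have h1 : V * (Wᴴ * Matrix.single a' a (1 : ℂ) * W) * Vᴴ =
      (V * Wᴴ) * Matrix.single a' a (1 : ℂ) * (V * Wᴴ)ᴴ := by
    rw [Matrix.conjTranspose_mul, Matrix.conjTranspose_conjTranspose]
    simp only [Matrix.mul_assoc]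
  change _ = Φ (Wᴴ * Matrix.single a' a 1 * W) b' b
  rw [(hVX _).1, h1]
  generalize V * Wᴴ = Y
  simp [traceSnd, Matrix.mul_apply, Matrix.single_apply, ite_and, mul_comm]

theorem IsComplementary.stateCoherentInfo_eq {E : Type} [Fintype E] [DecidableEq E]
    {Φe : Matrix A A ℂ →ₗ[ℂ] Matrix E E ℂ} (h : IsComplementary Φ Φc)
    (he : IsComplementary Φ Φe) (hρ : IsState ρ) :
    stateCoherentInfo Φ Φe ρ = stateCoherentInfo Φ Φc ρ := by
  obtain ⟨W, rfl⟩ := hρ.1.exists_eq_conjTranspose_mul_self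
  rw [stateCoherentInfo, stateCoherentInfo, h.entropy_eq, he.entropy_eq]

omit [DecidableEq A] in
theorem isState_pureState {ψ : A → ℂ} (hψ : star ψ ⬝ᵥ ψ = 1) : IsState (pureState ψ) :=
  ⟨Matrix.posSemidef_vecMulVec_self_star ψ, by
    rw [pureState, Matrix.trace_vecMulVec, dotProduct_comm, hψ]⟩

/-- Reshape `V *ᵥ ψ` into a matrix `T`; the outputs are `T * Tᴴ` and `(Tᴴ * T)ᵀ`. -/
theorem IsComplementary.entropy_pureState (h : IsComplementary Φ Φc) (ψ : A → ℂ) :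
    entropy (Φ (pureState ψ)) = entropy (Φc (pureState ψ)) := by
  obtain ⟨V, hV, hVX⟩ := h
  have h1 : V * pureState ψ * Vᴴ = Matrix.vecMulVec (V *ᵥ ψ) (star (V *ᵥ ψ)) := by
    rw [pureState, Matrix.mul_vecMulVec, Matrix.vecMulVec_mul, Matrix.star_mulVec]
  set T : Matrix B C ℂ := Matrix.of fun b c => (V *ᵥ ψ) (b, c) with hT
  have h2 : Φ (pureState ψ) = T * Tᴴ := by
    rw [(hVX _).1, h1]
    ext i j
    simp [traceSnd, Matrix.mul_apply, Matrix.vecMulVec_apply, hT]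
  have h3 : Φc (pureState ψ) = (Tᴴ * T)ᵀ := by
    rw [(hVX _).2, h1]
    ext i j
    simp [traceFst, Matrix.mul_apply, Matrix.vecMulVec_apply, hT, mul_comm]
  rw [h2, h3, entropy_transpose (Matrix.isHermitian_conjTranspose_mul_self T),
    entropy_mul_conjTranspose_comm]

theorem IsComplementary.continuousOn_stateCoherentInfo (h : IsComplementary Φ Φc) :
    ContinuousOn (stateCoherentInfo Φ Φc) {ρ | IsState ρ} :=
  (continuousOn_entropy.comp Φ.continuous_of_finiteDimensional.continuousOn
    fun _ hρ => h.isState hρ).sub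
  (continuousOn_entropy.comp Φc.continuous_of_finiteDimensional.continuousOn
    fun _ hρ => h.symm.isState hρ)

theorem IsComplementary.coherentInfo_eq (h : IsComplementary Φ Φc) :
    coherentInfo Φ = sSup {x : ℝ | ∃ ρ, IsState ρ ∧ x = stateCoherentInfo Φ Φc ρ} := by
  rw [coherentInfo]
  congr 1
  ext x
  constructor
  · rintro ⟨E, _, _, Φe, ρ, he, hρ, rfl⟩
    exact ⟨ρ, hρ, h.stateCoherentInfo_eq he hρ⟩
  · rintro ⟨ρ, hρ, rfl⟩
    exact ⟨C, _, _, Φc, ρ, h, hρ, rfl⟩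

theorem IsComplementary.isGreatest_coherentInfo [Nonempty A] (h : IsComplementary Φ Φc) :
    IsGreatest {x : ℝ | ∃ ρ, IsState ρ ∧ x = stateCoherentInfo Φ Φc ρ} (coherentInfo Φ) := by
  have himage : {x : ℝ | ∃ ρ, IsState ρ ∧ x = stateCoherentInfo Φ Φc ρ} =
      stateCoherentInfo Φ Φc '' {ρ | IsState ρ} := by
    ext x
    simp [eq_comm]
  have hne : {ρ : Matrix A A ℂ | IsState ρ}.Nonempty :=
    ⟨pureState (Pi.single (Classical.arbitrary A) 1), isState_pureState (by simp)⟩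
  rw [h.coherentInfo_eq, himage]
  exact (isCompact_setOf_isState.image_of_continuousOn
    h.continuousOn_stateCoherentInfo).isGreatest_sSup (hne.image _)

theorem IsComplementary.coherentInfo_pos (h : IsComplementary Φ Φc) {ψ : A → ℂ}
    {σ : Matrix A A ℂ} (hψ : star ψ ⬝ᵥ ψ = 1) (hσ : IsState σ)
    (hlt : (kerProj (Φc (pureState ψ)) * Φc σ).trace.re <
      (kerProj (Φ (pureState ψ)) * Φ σ).trace.re) :
    0 < coherentInfo Φ := by
  have := hσ.nonempty
  have hp := isState_pureState hψ
  obtain ⟨ε, h0, h1, hε⟩ := exists_entropy_mix_lt (h.isState hp) (h.isState hσ)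
    (h.symm.isState hp) (h.symm.isState hσ) (h.entropy_pureState ψ) hlt
  refine lt_of_lt_of_le (sub_pos.2 hε)
    (h.isGreatest_coherentInfo.2 ⟨_, hp.mix hσ h0.le h1, ?_⟩)
  simp only [stateCoherentInfo, map_add, LinearMap.map_smul_of_tower]

end Complementary

/-! ### Tensor powers of channels. -/

section TensorPower

variable {A B C : Type} [Fintype A] [DecidableEq A] [Fintype B] [Fintype C]
  {Φ : Matrix A A ℂ →ₗ[ℂ] Matrix B B ℂ} {Φc : Matrix A A ℂ →ₗ[ℂ] Matrix C C ℂ}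

/-- The `n`-th tensor power of `V : ℂ^A → ℂ^B ⊗ ℂ^C`, with the output factors rearranged. -/
def tensorPowerIsometry (V : Matrix (B × C) A ℂ) (n : ℕ) :
    Matrix ((Fin n → B) × (Fin n → C)) (Fin n → A) ℂ :=
  Matrix.of fun p x => ∏ k, V (p.1 k, p.2 k) (x k)

theorem sum_prod_eq_prod_sum {n : ℕ} {D : Type} [Fintype D] (f : Fin n → D → ℂ) :
    ∑ z : Fin n → D, ∏ k, f k (z k) = ∏ k, ∑ d, f k d := by
  rw [Finset.prod_univ_sum, Fintype.piFinset_univ]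

omit [Fintype A] in
theorem tensorPowerIsometry_conjTranspose_mul_self {V : Matrix (B × C) A ℂ} (hV : Vᴴ * V = 1)
    (n : ℕ) : (tensorPowerIsometry V n)ᴴ * tensorPowerIsometry V n = 1 := by
  ext x x'
  have h : ∀ i j, ∑ p : B × C, star (V p i) * V p j = if i = j then 1 else 0 := by
    intro i j
    have := congrFun (congrFun hV i) j
    rwa [Matrix.mul_apply, Matrix.one_apply] at this
  rw [Matrix.mul_apply, ← (Equiv.arrowProdEquivProdArrow (Fin n) (fun _ => B) fun _ => C).sum_comp]
  simp only [tensorPowerIsometry, Matrix.conjTranspose_apply, Matrix.of_apply, star_prod,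
    ← Finset.prod_mul_distrib]
  change ∑ p : Fin n → B × C, ∏ k, (star (V (p k) (x k)) * V (p k) (x' k)) = _
  rw [sum_prod_eq_prod_sum fun k p => star (V p (x k)) * V p (x' k)]
  simp only [h, Matrix.one_apply, funext_iff]
  rw [Finset.prod_ite_zero]
  simp

omit [Fintype B] in
theorem tensorPower_eq_traceSnd {V : Matrix (B × C) A ℂ}
    (hV : ∀ X, Φ X = traceSnd (V * X * Vᴴ)) (n : ℕ)
    (X : Matrix (Fin n → A) (Fin n → A) ℂ) :
    tensorPower Φ n X = traceSnd (tensorPowerIsometry V n * X * (tensorPowerIsometry V n)ᴴ) := by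
  have h : ∀ i j b b', Φ (Matrix.single i j 1) b b' = ∑ c, V (b, c) i * star (V (b', c) j) := by
    intro i j b b'
    rw [hV]
    simp [traceSnd, Matrix.mul_apply, Matrix.single_apply, ite_and]
  ext y y'
  simp only [tensorPower, LinearMap.coe_mk, AddHom.coe_mk, Matrix.of_apply, h, traceSnd,
    Matrix.mul_apply, Matrix.conjTranspose_apply, tensorPowerIsometry, Finset.sum_mul]
  have hprod : ∀ x x' : Fin n → A, ∏ k, ∑ c, V (y k, c) (x k) * star (V (y' k, c) (x' k)) =
      ∑ z : Fin n → C, (∏ k, V (y k, z k) (x k)) * star (∏ k, V (y' k, z k) (x' k)) := by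
    intro x x'
    rw [← sum_prod_eq_prod_sum fun k c => V (y k, c) (x k) * star (V (y' k, c) (x' k))]
    simp only [Finset.prod_mul_distrib, star_prod]
  simp only [hprod, Finset.mul_sum]
  refine Finset.sum_comm.trans (Eq.symm (Finset.sum_comm.trans ?_))
  refine Finset.sum_congr rfl fun x' _ => Finset.sum_comm.trans ?_
  exact Finset.sum_congr rfl fun x _ => Finset.sum_congr rfl fun z _ => by ring

theorem isComplementary_tensorPower (h : IsComplementary Φ Φc) (n : ℕ) :
    IsComplementary (tensorPower Φ n) (tensorPower Φc n) := by
  obtain ⟨V, hV, hVX⟩ := h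
  refine ⟨tensorPowerIsometry V n, tensorPowerIsometry_conjTranspose_mul_self hV n, fun X =>
    ⟨tensorPower_eq_traceSnd (fun X => (hVX X).1) n X, ?_⟩⟩
  -- Swapping the output factors turns the trace over the first into one over the second.
  exact tensorPower_eq_traceSnd (V := V.submatrix Prod.swap id) (fun X => (hVX X).2) n X

open scoped Kronecker in
omit [Fintype B] in
theorem tensorPower_add_reindex (m n : ℕ) (ρ : Matrix (Fin m → A) (Fin m → A) ℂ)
    (σ : Matrix (Fin n → A) (Fin n → A) ℂ) :
    tensorPower Φ (m + n)
      (Matrix.reindex (Fin.appendEquiv m n) (Fin.appendEquiv m n) (ρ ⊗ₖ σ)) =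
    Matrix.reindex (Fin.appendEquiv m n) (Fin.appendEquiv m n)
      (tensorPower Φ m ρ ⊗ₖ tensorPower Φ n σ) := by
  ext y y'
  obtain ⟨⟨y₁, y₂⟩, rfl⟩ := (Fin.appendEquiv m n).surjective y
  obtain ⟨⟨y₁', y₂'⟩, rfl⟩ := (Fin.appendEquiv m n).surjective y'
  simp only [tensorPower, LinearMap.coe_mk, AddHom.coe_mk, Matrix.of_apply, Matrix.reindex_apply,
    Matrix.submatrix_apply, Equiv.symm_apply_apply, Matrix.kroneckerMap_apply]
  refine ((Fin.appendEquiv m n).sum_comp _).symm.trans ?_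
  rw [Fintype.sum_prod_type, Finset.sum_mul_sum]
  refine Finset.sum_congr rfl fun x₁ _ => Finset.sum_congr rfl fun x₂ _ => ?_
  rw [Finset.sum_mul_sum]
  refine ((Fin.appendEquiv m n).sum_comp _).symm.trans ?_
  rw [Fintype.sum_prod_type]
  refine Finset.sum_congr rfl fun x₁' _ => Finset.sum_congr rfl fun x₂' _ => ?_
  simp only [Equiv.symm_apply_apply]
  simp only [Fin.prod_univ_add, Fin.appendEquiv, Equiv.coe_fn_mk,
    Fin.append_left, Fin.append_right]
  ring

omit [Fintype B] in
theorem tensorPower_one_reindex (ρ : Matrix A A ℂ) :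
    tensorPower Φ 1 (Matrix.reindex (Equiv.funUnique (Fin 1) A).symm
      (Equiv.funUnique (Fin 1) A).symm ρ) =
    Matrix.reindex (Equiv.funUnique (Fin 1) B).symm (Equiv.funUnique (Fin 1) B).symm (Φ ρ) := by
  ext y y'
  simp only [tensorPower, LinearMap.coe_mk, AddHom.coe_mk, Matrix.of_apply]
  refine ((Equiv.funUnique (Fin 1) A).symm.sum_comp _).symm.trans ?_
  conv_rhs => rw [Matrix.matrix_eq_sum_single ρ]
  simp only [map_sum, Matrix.reindex_apply, Matrix.submatrix_apply, Matrix.sum_apply]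
  refine Finset.sum_congr rfl fun i _ => ?_
  refine ((Equiv.funUnique (Fin 1) A).symm.sum_comp _).symm.trans ?_
  refine Finset.sum_congr rfl fun j _ => ?_
  have h : Matrix.single i j (ρ i j) = ρ i j • Matrix.single i j (1 : ℂ) := by
    rw [Matrix.smul_single, smul_eq_mul, mul_one]
  rw [h, map_smul]
  simp

end TensorPower

/-! ### Superadditivity and the regularized limit. -/

section Capacity

variable {A B C : Type} [Fintype A] [DecidableEq A] [Nonempty A] [Fintype B] [DecidableEq B]
  [Fintype C] [DecidableEq C]
  {Φ : Matrix A A ℂ →ₗ[ℂ] Matrix B B ℂ} {Φc : Matrix A A ℂ →ₗ[ℂ] Matrix C C ℂ}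

omit [DecidableEq A] [Nonempty A] in
theorem IsState.reindex {D : Type} [Fintype D] {ρ : Matrix A A ℂ} (hρ : IsState ρ)
    (e : A ≃ D) : IsState (Matrix.reindex e e ρ) := by
  refine ⟨hρ.1.submatrix _, ?_⟩
  rw [← hρ.2]
  exact e.symm.sum_comp fun i => ρ i i

open scoped Kronecker in
omit [DecidableEq A] [Nonempty A] in
theorem IsState.kronecker {D : Type} [Fintype D] {ρ : Matrix A A ℂ} {σ : Matrix D D ℂ}
    (hρ : IsState ρ) (hσ : IsState σ) : IsState (ρ ⊗ₖ σ) :=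
  ⟨hρ.1.kronecker hσ.1, by rw [Matrix.trace_kronecker, hρ.2, hσ.2, one_mul]⟩

/-- The product of two maximizers is a trial state, and both output entropies are additive on it. -/
theorem IsComplementary.coherentInfo_tensorPower_add_le (h : IsComplementary Φ Φc) (m n : ℕ) :
    coherentInfo (tensorPower Φ m) + coherentInfo (tensorPower Φ n) ≤
      coherentInfo (tensorPower Φ (m + n)) := by
  obtain ⟨ρ, hρ, hm⟩ := (isComplementary_tensorPower h m).isGreatest_coherentInfo.1
  obtain ⟨σ, hσ, hn⟩ := (isComplementary_tensorPower h n).isGreatest_coherentInfo.1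
  refine (isComplementary_tensorPower h (m + n)).isGreatest_coherentInfo.2
    ⟨_, (hρ.kronecker hσ).reindex (Fin.appendEquiv m n), ?_⟩
  have h1 := (isComplementary_tensorPower h m).isState hρ
  have h2 := (isComplementary_tensorPower h n).isState hσ
  have h3 := (isComplementary_tensorPower h m).symm.isState hρ
  have h4 := (isComplementary_tensorPower h n).symm.isState hσ
  rw [hm, hn, stateCoherentInfo, stateCoherentInfo, stateCoherentInfo, tensorPower_add_reindex,
    tensorPower_add_reindex, entropy_reindex _ (h1.kronecker h2).1.1,
    entropy_reindex _ (h3.kronecker h4).1.1, entropy_kronecker h1.1.1 h2.1.1 h1.2 h2.2,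
    entropy_kronecker h3.1.1 h4.1.1 h3.2 h4.2]
  ring

theorem IsComplementary.coherentInfo_le_tensorPower_one (h : IsComplementary Φ Φc) :
    coherentInfo Φ ≤ coherentInfo (tensorPower Φ 1) := by
  obtain ⟨ρ, hρ, hm⟩ := h.isGreatest_coherentInfo.1
  refine (isComplementary_tensorPower h 1).isGreatest_coherentInfo.2
    ⟨_, hρ.reindex (Equiv.funUnique (Fin 1) A).symm, ?_⟩
  rw [hm, stateCoherentInfo, stateCoherentInfo, tensorPower_one_reindex, tensorPower_one_reindex,
    entropy_reindex _ (h.isState hρ).1.1, entropy_reindex _ (h.symm.isState hρ).1.1]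

theorem IsComplementary.coherentInfo_tensorPower_le (h : IsComplementary Φ Φc) (n : ℕ) :
    coherentInfo (tensorPower Φ n) ≤ n * Real.log (Fintype.card B) := by
  obtain ⟨ρ, hρ, hm⟩ := (isComplementary_tensorPower h n).isGreatest_coherentInfo.1
  have h1 := ((isComplementary_tensorPower h n).isState hρ).entropy_le_log_card
  have h2 := ((isComplementary_tensorPower h n).symm.isState hρ).entropy_nonneg
  rw [Fintype.card_fun, Fintype.card_fin, Nat.cast_pow, Real.log_pow] at h1
  rw [hm, stateCoherentInfo]
  linarith

/-- Fekete's lemma for the negated sequence: the limit is an infimum over `n ≥ 1`, and the term `n =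
1` gives the inequality. -/
theorem IsComplementary.tendsto_quantumCapacity (h : IsComplementary Φ Φc) :
    Filter.Tendsto (fun n : ℕ => coherentInfo (tensorPower Φ n) / n) Filter.atTop
      (nhds (quantumCapacity Φ)) ∧ coherentInfo Φ ≤ quantumCapacity Φ := by
  have hsub : Subadditive fun n => -coherentInfo (tensorPower Φ n) := fun m n => by
    linarith [h.coherentInfo_tensorPower_add_le m n]
  have hbdd : BddBelow (Set.range fun n : ℕ => -coherentInfo (tensorPower Φ n) / n) := by
    refine ⟨-Real.log (Fintype.card B), ?_⟩
    rintro _ ⟨n, rfl⟩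
    beta_reduce
    -- At `n = 0` the quotient is `0` by convention, so the bound needs only a nonnegative
    -- logarithm.
    rcases n.eq_zero_or_pos with rfl | hn
    · simpa using Real.log_natCast_nonneg _
    · rw [le_div_iff₀ (Nat.cast_pos.2 hn)]
      linarith [h.coherentInfo_tensorPower_le n]
  have hlim := (hsub.tendsto_lim hbdd).neg
  simp only [neg_div, neg_neg] at hlim
  have hQ : quantumCapacity Φ = -hsub.lim := hlim.limUnder_eq
  refine ⟨hQ ▸ hlim, ?_⟩
  have h1 := hsub.lim_le_div hbdd one_ne_zero
  rw [Nat.cast_one, div_one] at h1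
  linarith [h.coherentInfo_le_tensorPower_one]

theorem IsComplementary.quantumCapacity_pos (h : IsComplementary Φ Φc) {ψ : A → ℂ}
    {σ : Matrix A A ℂ} (hψ : star ψ ⬝ᵥ ψ = 1) (hσ : IsState σ)
    (hlt : (kerProj (Φc (pureState ψ)) * Φc σ).trace.re <
      (kerProj (Φ (pureState ψ)) * Φ σ).trace.re) :
    IsGreatest {x : ℝ | ∃ ρ, IsState ρ ∧ x = stateCoherentInfo Φ Φc ρ} (coherentInfo Φ) ∧
      Filter.Tendsto (fun n : ℕ => coherentInfo (tensorPower Φ n) / n) Filter.atTop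
        (nhds (quantumCapacity Φ)) ∧
      quantumCapacity Φ ≥ coherentInfo Φ ∧ coherentInfo Φ > 0 :=
  ⟨h.isGreatest_coherentInfo, h.tendsto_quantumCapacity.1, h.tendsto_quantumCapacity.2,
    h.coherentInfo_pos hψ hσ hlt⟩

end Capacity

end

end QuantumCapacity

open QuantumCapacity in
theorem theorem3p1 (d dOut dEnv : ℕ)
    (Φ : Matrix (Fin d) (Fin d) ℂ →ₗ[ℂ] Matrix (Fin dOut) (Fin dOut) ℂ)
    (Φc : Matrix (Fin d) (Fin d) ℂ →ₗ[ℂ] Matrix (Fin dEnv) (Fin dEnv) ℂ)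
    (hΦ : IsChannel Φ) (hΦc : IsChannel Φc) (hcompl : IsComplementary Φ Φc) :
    ((∃ (ψ : Fin d → ℂ) (σ : Matrix (Fin d) (Fin d) ℂ), star ψ ⬝ᵥ ψ = 1 ∧ IsState σ ∧
        (kerProj (Φ (pureState ψ)) * Φ σ).trace.re >
          (kerProj (Φc (pureState ψ)) * Φc σ).trace.re) →
      IsGreatest {x : ℝ | ∃ ρ, IsState ρ ∧ x = stateCoherentInfo Φ Φc ρ} (coherentInfo Φ) ∧
      Filter.Tendsto (fun n : ℕ => coherentInfo (tensorPower Φ n) / n) Filter.atTop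
        (nhds (quantumCapacity Φ)) ∧
      quantumCapacity Φ ≥ coherentInfo Φ ∧ coherentInfo Φ > 0) ∧
    ((∃ (ψ : Fin d → ℂ) (σ : Matrix (Fin d) (Fin d) ℂ), star ψ ⬝ᵥ ψ = 1 ∧ IsState σ ∧
        (kerProj (Φ (pureState ψ)) * Φ σ).trace.re <
          (kerProj (Φc (pureState ψ)) * Φc σ).trace.re) →
      IsGreatest {x : ℝ | ∃ ρ, IsState ρ ∧ x = stateCoherentInfo Φc Φ ρ} (coherentInfo Φc) ∧
      Filter.Tendsto (fun n : ℕ => coherentInfo (tensorPower Φc n) / n) Filter.atTop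
        (nhds (quantumCapacity Φc)) ∧
      quantumCapacity Φc ≥ coherentInfo Φc ∧ coherentInfo Φc > 0) := by
  constructor
  · rintro ⟨ψ, σ, hψ, hσ, hlt⟩
    -- A matrix of trace one excludes `d = 0`, where there would be no state to maximize over.
    have := hσ.nonempty
    exact hcompl.quantumCapacity_pos hψ hσ hlt
  · rintro ⟨ψ, σ, hψ, hσ, hlt⟩
    have := hσ.nonempty
    exact hcompl.symm.quantumCapacity_pos hψ hσ hlt
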